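/- Let $G$ be a finite directed graph (antiparallel edges, and also parallel edges, are allowed) with non-negative real edge costs $c$, let $n=|V(G)|$, $s\in V(G)$, and let $p\ge 0$ be an integer. Paths are directed and visit no vertex twice. Suppose that $G$ is $p$-edge-outconnected from $s$, i.e. for every $t\ne s$ there are $p$ pairwise edge-disjoint paths from $s$ to $t$ in $G$. Construct subgraphs $H_0\subseteq H_1\subseteq\dots\subseteq H_p$ of $G$ on the vertex set $V(G)$ as follows. $H_0$ has no edges. In iteration $i$ ($1\le i\le p$), do the following for every $t\ne s$. Choose any $i-1$ pairwise edge-disjoint paths from $s$ to $t$ in $H_{i-1}$ that have minimum total cost among all such families in $H_{i-1}$, and let $S^t_{i-1}$ be the set of their edges. Let $G^t_{i-1}$ be the graph obtained from $G$ by reversing every edge of $S^t_{i-1}$ and replacing its cost by the negative. For a path $\pi$ in $G^t_{i-1}$ let $c(\pi)$ be its cost and $\eta(\pi)$ the number of its edges that are in $E(G)\setminus E(H_{i-1})$. Choose any path $\pi_t$ from $s$ to $t$ in $G^t_{i-1}$ for which the pair $(c(\pi_t),\eta(\pi_t))$ is lexicographically minimum, and let $e_t$ be its last edge. Then $H_i$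 is obtained from $H_{i-1}$ by adding the edges $e_t$, for all $t\ne s$. Then all these iterations can be carried out, whatever choices are made, and the resulting $H_p$ is a single-source $p$-multipath preserver: for every $t\neq s$, $H_p$ contains $p$ pairwise edge-disjoint paths from $s$ to $t$ whose total cost is minimum among all families of $p$ pairwise edge-disjoint paths from $s$ to $t$ in $G$. Moreover, in $H_p$ the vertex $s$ has in-degree $0$ and every other vertex has in-degree exactly $p$; in particular $H_p$ has exactly $p(n-1)$ edges. -/

import Mathlib

/-- A directed graph with vertex set `V`, edge set `E` and real edge costs. Edges are named, so that
oppositely directed (and also parallel) edges remain distinguishable, in the graph itself and after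
some of its edges have been reversed. An ordinary directed graph is the case in which
`e ↦ (src e, tgt e)` is injective. Subgraphs on the vertex set `V` are given by their edge sets. -/
structure CostDigraph (V E : Type*) where
  src : E → V
  tgt : E → V
  cost : E → ℝ

namespace CostDigraph

variable {V E : Type*}

/-- `G.IsWalk u l v`: the consecutive edges of the list `l` form a directed walk from `u` to `v`. -/
def IsWalk (G : CostDigraph V E) : V → List E → V → Prop
  | u, [], v => u = v
  | u, e :: l, v => G.src e = u ∧ G.IsWalk (G.tgt e) l v

/-- `G.IsPath u l v`: the list `l` is a directed path from `u` to `v`, that is, a walk that visits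
no vertex twice. -/
def IsPath (G : CostDigraph V E) (u : V) (l : List E) (v : V) : Prop :=
  G.IsWalk u l v ∧ (u :: l.map G.tgt).Nodup

/-- The cost of a path: the sum of the costs of its edges. -/
def pathCost (G : CostDigraph V E) (l : List E) : ℝ := (l.map G.cost).sum

/-- `P` is a family of `k` pairwise edge-disjoint paths from `s` to `t` all of whose edges lie
in `A`. -/
def EdgeDisjointPaths (G : CostDigraph V E) (A : Finset E) (s t : V) {k : ℕ}
    (P : Fin k → List E) : Prop :=
  (∀ j, G.IsPath s (P j) t ∧ ∀ e ∈ P j, e ∈ A) ∧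
    Pairwise fun j j' => List.Disjoint (P j) (P j')

/-- The total cost of a family of paths. -/
def totalCost (G : CostDigraph V E) {k : ℕ} (P : Fin k → List E) : ℝ :=
  ∑ j, G.pathCost (P j)

/-- `P` is a family of `k` edge-disjoint paths from `s` to `t` in the subgraph `A` whose total cost
is minimum among all such families in the subgraph `A`. -/
def MinCostPaths (G : CostDigraph V E) (A : Finset E) (s t : V) {k : ℕ}
    (P : Fin k → List E) : Prop :=
  G.EdgeDisjointPaths A s t P ∧
    ∀ Q : Fin k → List E, G.EdgeDisjointPaths A s t Q → G.totalCost P ≤ G.totalCost Q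

/-- `G` is `p`-edge-outconnected from `s`. -/
def EdgeOutconnected [Fintype E] (G : CostDigraph V E) (p : ℕ) (s : V) : Prop :=
  ∀ t, t ≠ s → ∃ P : Fin p → List E, G.EdgeDisjointPaths Finset.univ s t P

/-- The subgraph `H` is a single-source `p`-multipath preserver: for every `t ≠ s` it contains `p`
edge-disjoint paths from `s` to `t` whose total cost is minimum among all families of `p`
edge-disjoint paths from `s` to `t` in the whole graph `G`. -/
def MultipathPreserver [Fintype E] (G : CostDigraph V E) (p : ℕ) (s : V) (H : Finset E) : Prop :=
  ∀ t, t ≠ s → ∃ P : Fin p → List E,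
    G.EdgeDisjointPaths H s t P ∧ G.MinCostPaths Finset.univ s t P

/-- The in-degree of `v` in the subgraph `H`. -/
def inDegree [DecidableEq V] (G : CostDigraph V E) (H : Finset E) (v : V) : ℕ :=
  (H.filter fun e => G.tgt e = v).card

variable [DecidableEq E]

/-- The set of all edges of a family of paths. -/
def pathEdges {k : ℕ} (P : Fin k → List E) : Finset E :=
  Finset.univ.biUnion fun j => (P j).toFinset

/-- The graph obtained from `G` by reversing the edges in `S`; a reversed edge gets the opposite
cost. -/
def residual (G : CostDigraph V E) (S : Finset E) : CostDigraph V E where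
  src e := if e ∈ S then G.tgt e else G.src e
  tgt e := if e ∈ S then G.src e else G.tgt e
  cost e := if e ∈ S then -G.cost e else G.cost e

/-- The length of a path in a residual network, relative to the current subgraph `H`: its cost
together with the number of its edges that belong to `G` but not to `H`. These pairs are compared
lexicographically. (Only edges of `H` are ever reversed below, so an edge outside `H` is always
an unreversed edge of `G`.) -/
def lexLength (G : CostDigraph V E) (H : Finset E) (l : List E) : ℝ ×ₗ ℕ :=
  toLex (G.pathCost l, l.countP (· ∉ H))

/-- `l` is a path from `s` to `t` in `G` that is shortest with respect to `lexLength`. -/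
def IsShortestPath (G : CostDigraph V E) (H : Finset E) (s : V) (l : List E) (t : V) : Prop :=
  G.IsPath s l t ∧ ∀ l', G.IsPath s l' t → G.lexLength H l ≤ G.lexLength H l'

/-- One iteration of the construction, which turns the subgraph `H` obtained after `i` iterations
into the subgraph `H'`. For every `t ≠ s`, choose arbitrarily
* `i` edge-disjoint paths `P t` from `s` to `t` of minimum total cost in `H`, and
* a shortest path `π t` from `s` to `t`, with respect to `lexLength`, in the residual network
  obtained from `G` by reversing the edges of `P t`;
then add to `H` the last edge of `π t`, for every `t ≠ s`. -/
def Iteration (G : CostDigraph V E) (s : V) (i : ℕ) (H H' : Finset E) : Prop :=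
  ∃ (P : V → Fin i → List E) (π : V → List E),
    (∀ t, t ≠ s → G.MinCostPaths H s t (P t)) ∧
    (∀ t, t ≠ s → (G.residual (pathEdges (P t))).IsShortestPath H s (π t) t) ∧
    ∀ e, e ∈ H' ↔ e ∈ H ∨ ∃ t, t ≠ s ∧ (π t).getLast? = some e

/-- `G.Constructed s i H`: the subgraph `H` is a possible outcome `H_i` of the first `i` iterations
of the construction, which starts from the subgraph without edges. -/
inductive Constructed (G : CostDigraph V E) (s : V) : ℕ → Finset E → Prop
  | zero : Constructed G s 0 ∅
  | succ {i : ℕ} {H H' : Finset E} :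
      Constructed G s i H → G.Iteration s i H H' → Constructed G s (i + 1) H'

end CostDigraph

/-! Families of k edge-disjoint paths are replaced by sets of edges with boundary k(t - s), that is,
0-1 flows, possibly with extra circulations. Costs are non-negative, so extracting paths never
raises the cost. Augmentation and exchange are then symmetric differences of sets.

Edges are weighed by (cost, number outside `H`) in an ordered group. The second entry makes the
weight of every edge outside `H` positive, even at cost 0. The invariant is that `H` is an
i-multipath preserver with in-degree i at each t ≠ s and 0 at s. By counting in-degrees, a minimum
flow S_t in `H` uses all edges of `H` into t and none out of t. So e_t is a new edge that enters t,
which gives the degree claims.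

For optimality, let d(t) be the length of the augmenting path to t. The induction on d(t) in
`IsAugmentation.exists_flow` shows that `H'` contains a minimum-weight flow of value i + 1 to t.
Among the minimum-weight flows whose edges into t lie in `H'`, take one, A, with fewest edges
outside `H'`, and let f ∈ A \ H' enter v. By `IsAugmentation.length_lt`, d(v) < d(t), so `H'`
contains a minimum-weight flow Q to v. By `IsFlow.exchange`, f can be traded against edges of Q
without changing the values of the flows. Both stay minimum, and A has lost an edge outside `H'`, a
contradiction. -/

namespace CostDigraph

variable {V E : Type*}

/-! ### Directed paths: shortening, reachability, last edges, finiteness. -/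

theorem IsPath.nodup {G : CostDigraph V E} {u v : V} {l : List E} (h : G.IsPath u l v) :
    l.Nodup :=
  List.Nodup.of_map _ (List.nodup_cons.1 h.2).2

/-- A path can be shortened to start at any vertex that it visits. -/
theorem IsPath.exists_suffix {G : CostDigraph V E} {v x : V} :
    ∀ {u : V} {l : List E}, G.IsPath u l v → x ∈ u :: l.map G.tgt →
      ∃ l', G.IsPath x l' v ∧ l' ⊆ l
  | u, [], h, hx => by
    obtain rfl : x = u := by simpa using hx
    exact ⟨[], h, List.Subset.refl _⟩
  | u, e :: l, h, hx => by
    rcases List.mem_cons.1 hx with rfl | hx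
    · exact ⟨e :: l, h, List.Subset.refl _⟩
    · have h' : G.IsPath (G.tgt e) l v := ⟨h.1.2, (List.nodup_cons.1 h.2).2⟩
      obtain ⟨l', h1, h2⟩ := h'.exists_suffix hx
      exact ⟨l', h1, fun a ha => List.mem_cons_of_mem _ (h2 ha)⟩

/-- An edge followed by a path can be shortened to a path. -/
theorem IsPath.exists_cons {G : CostDigraph V E} {v : V} {e : E} {l : List E}
    (h : G.IsPath (G.tgt e) l v) : ∃ l', G.IsPath (G.src e) l' v ∧ l' ⊆ e :: l := by
  by_cases hx : G.src e ∈ G.tgt e :: l.map G.tgt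
  · obtain ⟨l', h1, h2⟩ := h.exists_suffix hx
    exact ⟨l', h1, fun a ha => List.mem_cons_of_mem _ (h2 ha)⟩
  · exact ⟨e :: l, ⟨⟨rfl, h.1⟩, List.nodup_cons.2 ⟨hx, h.2⟩⟩, List.Subset.refl _⟩

/-- The vertices from which `y` can be reached through `A` form a set that no edge of `A` enters. -/
theorem exists_reaching_set [Fintype V] (G : CostDigraph V E) (A : Finset E) (y : V) :
    ∃ W : Finset V, y ∈ W ∧ (∀ x ∈ W, ∃ l, G.IsPath x l y ∧ ∀ e ∈ l, e ∈ A) ∧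
      ∀ e ∈ A, G.tgt e ∈ W → G.src e ∈ W := by
  classical
  refine ⟨Finset.univ.filter fun z => ∃ l, G.IsPath z l y ∧ ∀ e ∈ l, e ∈ A, ?_, ?_, ?_⟩
  · simp only [Finset.mem_filter, Finset.mem_univ, true_and]
    exact ⟨[], ⟨rfl, by simp⟩, by simp⟩
  · simp
  · simp only [Finset.mem_filter, Finset.mem_univ, true_and]
    rintro e he ⟨l, hl, hA⟩
    obtain ⟨l', h1, h2⟩ := hl.exists_cons
    refine ⟨l', h1, fun a ha => ?_⟩
    rcases List.mem_cons.1 (h2 ha) with rfl | ha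
    exacts [he, hA a ha]

theorem IsWalk.getLast_tgt {G : CostDigraph V E} {v : V} {e : E} :
    ∀ {u : V} {l : List E}, G.IsWalk u l v → l.getLast? = some e → G.tgt e = v
  | _, [], _, he => by simp at he
  | _, [a], h, he => by
    obtain rfl : a = e := by simpa using he
    exact h.2
  | _, _ :: b :: l, h, he => by
    rw [List.getLast?_cons_cons] at he
    exact IsWalk.getLast_tgt h.2 he

theorem IsPath.getLast?_eq_of_tgt {G : CostDigraph V E} {u v : V} {l : List E}
    (h : G.IsPath u l v) {e : E} (he : e ∈ l) (ht : G.tgt e = v) : l.getLast? = some e := by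
  obtain ⟨a, ha⟩ : ∃ a, l.getLast? = some a := by
    cases l with
    | nil => simp at he
    | cons b l => exact ⟨_, List.getLast?_eq_some_getLast (by simp)⟩
  have hinj := List.inj_on_of_nodup_map (List.nodup_cons.1 h.2).2
  rw [ha, hinj (List.mem_of_getLast? ha) he ((h.1.getLast_tgt ha).trans ht.symm)]

/-- The set of paths between two vertices is finite. -/
theorem finite_setOf_isPath [Fintype V] [Fintype E] (G : CostDigraph V E) (u v : V) :
    {l | G.IsPath u l v}.Finite := by
  refine (List.finite_length_le E (Fintype.card E)).subset fun l hl => ?_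
  exact List.Nodup.length_le_card (IsPath.nodup hl)

theorem exists_isShortestPath [Fintype V] [Fintype E] [DecidableEq E] (G : CostDigraph V E)
    (H : Finset E) {s t : V} {l : List E}
    (hl : G.IsPath s l t) : ∃ l, G.IsShortestPath H s l t := by
  obtain ⟨l', h1, h2⟩ := Set.exists_min_image {l | G.IsPath s l t} (G.lexLength H)
    (G.finite_setOf_isPath s t) ⟨l, hl⟩
  exact ⟨l', h1, h2⟩

theorem EdgeDisjointPaths.mono {G : CostDigraph V E}
    {A B : Finset E} {s t : V} {k : ℕ} {P : Fin k → List E} (h : G.EdgeDisjointPaths A s t P)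
    (hAB : A ⊆ B) : G.EdgeDisjointPaths B s t P :=
  ⟨fun j => ⟨(h.1 j).1, fun e he => hAB ((h.1 j).2 e he)⟩, h.2⟩

/-! ### Additive weights under symmetric differences. -/

section Sums

variable [DecidableEq E]

theorem EdgeDisjointPaths.sum_pathEdges {M : Type*} [AddCommMonoid M] {G : CostDigraph V E}
    {A : Finset E} {s t : V} {k : ℕ} {P : Fin k → List E} (h : G.EdgeDisjointPaths A s t P)
    (g : E → M) : ∑ e ∈ pathEdges P, g e = ∑ j, ((P j).map g).sum := by
  rw [pathEdges, Finset.sum_biUnion]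
  · exact Finset.sum_congr rfl fun j _ => List.sum_toFinset _ (h.1 j).1.nodup
  · intro i _ j _ hij
    rw [Function.onFun, Finset.disjoint_left]
    intro a ha hb
    exact h.2 hij (List.mem_toFinset.1 ha) (List.mem_toFinset.1 hb)

theorem EdgeDisjointPaths.pathEdges_subset {G : CostDigraph V E}
    {A : Finset E} {s t : V} {k : ℕ} {P : Fin k → List E} (h : G.EdgeDisjointPaths A s t P) :
    pathEdges P ⊆ A := by
  intro e he
  simp only [pathEdges, Finset.mem_biUnion, List.mem_toFinset] at he
  obtain ⟨j, -, hj⟩ := he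
  exact (h.1 j).2 e hj

theorem EdgeDisjointPaths.totalCost_eq {G : CostDigraph V E}
    {A : Finset E} {s t : V} {k : ℕ} {P : Fin k → List E} (h : G.EdgeDisjointPaths A s t P) :
    G.totalCost P = ∑ e ∈ pathEdges P, G.cost e :=
  (h.sum_pathEdges G.cost).symm

/-- A weight on the edges of `G`, as seen in the residual network of `S`. -/
def signed {M : Type*} [Neg M] (S : Finset E) (g : E → M) (e : E) : M :=
  if e ∈ S then -g e else g e

theorem sum_symmDiff {M : Type*} [AddCommGroup M] (S C : Finset E) (g : E → M) :
    ∑ e ∈ symmDiff S C, g e = ∑ e ∈ S, g e + ∑ e ∈ C, signed S g e := by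
  have h1 : ∑ e ∈ symmDiff S C, g e = ∑ e ∈ S \ C, g e + ∑ e ∈ C \ S, g e := by
    rw [← Finset.sum_union (disjoint_sdiff_sdiff), ← Finset.sup_eq_union]
    rfl
  have h2 := Finset.sum_inter_add_sum_sdiff S C g
  have h3 := Finset.sum_inter_add_sum_sdiff C S (signed S g)
  have h4 : ∑ e ∈ C ∩ S, signed S g e = -∑ e ∈ S ∩ C, g e := by
    rw [Finset.inter_comm, ← Finset.sum_neg_distrib]
    exact Finset.sum_congr rfl fun e he => if_pos (Finset.mem_inter.1 he).1
  have h5 : ∑ e ∈ C \ S, signed S g e = ∑ e ∈ C \ S, g e :=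
    Finset.sum_congr rfl fun e he => if_neg (Finset.mem_sdiff.1 he).2
  rw [h1, ← h2, ← h3, h4, h5]
  abel

/-- Exchanging part of the symmetric difference of two sets preserves the total weight. -/
theorem sum_exchange {M : Type*} [AddCommGroup M] {A Q C : Finset E} (hC : C ⊆ symmDiff Q A)
    (g : E → M) :
    ∑ e ∈ symmDiff A C, g e + ∑ e ∈ symmDiff Q C, g e = ∑ e ∈ A, g e + ∑ e ∈ Q, g e := by
  -- Each edge of `C` lies in exactly one of `A` and `Q`, so its two signs are opposite.
  have h : ∑ e ∈ C, signed A g e + ∑ e ∈ C, signed Q g e = 0 := by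
    rw [← Finset.sum_add_distrib]
    refine Finset.sum_eq_zero fun e he => ?_
    rcases Finset.mem_symmDiff.1 (hC he) with ⟨h1, h2⟩ | ⟨h1, h2⟩ <;> simp [signed, h1, h2]
  rw [sum_symmDiff, sum_symmDiff, add_add_add_comm, h, add_zero]

end Sums

/-! ### Integral flows as edge sets: decomposition, residual networks, exchange. -/

section Flow

variable [DecidableEq V]

/-- The boundary of an edge, head minus tail. -/
def boundary (G : CostDigraph V E) (e : E) : V → ℤ :=
  Pi.single (G.tgt e) 1 - Pi.single (G.src e) 1

/-- The set of edges `A` is an integral flow of value `k` from `s` to `t`. -/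
def IsFlow (G : CostDigraph V E) (A : Finset E) (s t : V) (k : ℕ) : Prop :=
  ∑ e ∈ A, G.boundary e = k • (Pi.single t 1 - Pi.single s 1 : V → ℤ)

theorem IsWalk.sum_boundary {G : CostDigraph V E} {v : V} :
    ∀ {u : V} {l : List E}, G.IsWalk u l v →
      (l.map G.boundary).sum = (Pi.single v 1 - Pi.single u 1 : V → ℤ)
  | _, [], h => by
    obtain rfl := h
    simp
  | _, e :: l, h => by
    obtain ⟨rfl, h⟩ := h
    rw [List.map_cons, List.sum_cons, IsWalk.sum_boundary h, boundary]
    abel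

theorem IsPath.sum_boundary [DecidableEq E] {G : CostDigraph V E} {u v : V} {l : List E}
    (h : G.IsPath u l v) :
    ∑ e ∈ l.toFinset, G.boundary e = (Pi.single v 1 - Pi.single u 1 : V → ℤ) := by
  rw [List.sum_toFinset _ h.nodup, h.1.sum_boundary]

theorem sum_boundary_apply (G : CostDigraph V E) (A : Finset E) (x : V) :
    (∑ e ∈ A, G.boundary e) x = G.inDegree A x - (A.filter fun e => G.src e = x).card := by
  simp only [Finset.sum_apply, boundary, Pi.sub_apply, Finset.sum_sub_distrib, Pi.single_apply,
    inDegree, eq_comm (a := x), Finset.sum_boole]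

theorem IsFlow.inDegree_eq {G : CostDigraph V E} {A : Finset E} {s t : V} {k : ℕ}
    (h : G.IsFlow A s t k) (hts : t ≠ s) :
    G.inDegree A t = k + (A.filter fun e => G.src e = t).card := by
  have := G.sum_boundary_apply A t
  rw [h] at this
  simp [hts] at this
  omega

theorem card_eq_mul_of_inDegree [Fintype V] (G : CostDigraph V E) {H : Finset E} {s : V} {p : ℕ}
    (hs : G.inDegree H s = 0) (hdeg : ∀ t, t ≠ s → G.inDegree H t = p) :
    H.card = p * (Fintype.card V - 1) := by
  rw [Finset.card_eq_sum_card_fiberwise (f := G.tgt) (t := Finset.univ) (by simp),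
    ← Finset.add_sum_erase _ _ (Finset.mem_univ s)]
  change G.inDegree H s + ∑ v ∈ Finset.univ.erase s, G.inDegree H v = _
  rw [hs, zero_add, Finset.sum_congr rfl fun t ht => hdeg t (Finset.ne_of_mem_erase ht),
    Finset.sum_const, Finset.card_erase_of_mem (Finset.mem_univ s), Finset.card_univ, smul_eq_mul,
    mul_comm]

theorem sum_single_apply (W : Finset V) (v : V) :
    ∑ x ∈ W, (Pi.single v 1 : V → ℤ) x = if v ∈ W then 1 else 0 := by
  simp [Pi.single_apply]

/-- A set of vertices that is entered by no edge of `A` has nonpositive excess. -/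
theorem sum_boundary_nonpos (G : CostDigraph V E) {A : Finset E} {W : Finset V}
    (hW : ∀ e ∈ A, G.tgt e ∈ W → G.src e ∈ W) :
    ∑ x ∈ W, (∑ e ∈ A, G.boundary e) x ≤ 0 := by
  simp only [Finset.sum_apply]
  rw [Finset.sum_comm]
  refine Finset.sum_nonpos fun e he => ?_
  simp only [boundary, Pi.sub_apply, Finset.sum_sub_distrib, sum_single_apply]
  have := hW e he
  split_ifs <;> simp_all

/-- If moreover an edge of `A` leaves the set, then its excess is negative. -/
theorem sum_boundary_neg (G : CostDigraph V E) {A : Finset E} {W : Finset V}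
    (hW : ∀ e ∈ A, G.tgt e ∈ W → G.src e ∈ W) {f : E} (hf : f ∈ A) (hs : G.src f ∈ W)
    (ht : G.tgt f ∉ W) : ∑ x ∈ W, (∑ e ∈ A, G.boundary e) x < 0 := by
  classical
  rw [← Finset.add_sum_erase _ _ hf]
  simp only [Pi.add_apply, Finset.sum_add_distrib]
  have h1 := G.sum_boundary_nonpos (A := A.erase f) (W := W)
    fun e he => hW e (Finset.mem_of_mem_erase he)
  have h2 : ∑ x ∈ W, G.boundary f x = -1 := by
    simp [boundary, Finset.sum_sub_distrib, -Finset.sum_pi_single, hs, ht]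
  omega

/-- A set of edges whose excess is positive on all sets of vertices that separate `y` from `x`
contains a path from `x` to `y`. -/
theorem exists_isPath_of_excess [Fintype V] (G : CostDigraph V E) {A : Finset E} {x y : V}
    (h : ∀ W : Finset V, y ∈ W → x ∉ W → 0 < ∑ z ∈ W, (∑ e ∈ A, G.boundary e) z) :
    ∃ l, G.IsPath x l y ∧ ∀ e ∈ l, e ∈ A := by
  obtain ⟨W, hy, hpath, hW⟩ := G.exists_reaching_set A y
  by_contra hx
  exact absurd (h W hy fun h => hx (hpath x h)) (G.sum_boundary_nonpos hW).not_gt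

theorem sum_flow (W : Finset V) (s t : V) (k : ℕ) :
    ∑ x ∈ W, (k • (Pi.single t 1 - Pi.single s 1 : V → ℤ)) x =
      k * ((if t ∈ W then 1 else 0) - if s ∈ W then 1 else 0) := by
  simp only [Pi.smul_apply, Pi.sub_apply]
  rw [← Finset.smul_sum, Finset.sum_sub_distrib, sum_single_apply, sum_single_apply, nsmul_eq_mul]

theorem IsFlow.exists_isPath [Fintype V] {G : CostDigraph V E} {A : Finset E} {s t : V} {k : ℕ}
    (h : G.IsFlow A s t k) (hk : 0 < k) : ∃ l, G.IsPath s l t ∧ ∀ e ∈ l, e ∈ A := by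
  refine G.exists_isPath_of_excess fun W ht hs => ?_
  rw [h, sum_flow]
  simp [ht, hs, hk]

variable [DecidableEq E]

theorem IsFlow.sdiff_path {G : CostDigraph V E} {A : Finset E} {s t : V} {k : ℕ}
    (h : G.IsFlow A s t (k + 1)) {l : List E} (hl : G.IsPath s l t) (hA : ∀ e ∈ l, e ∈ A) :
    G.IsFlow (A \ l.toFinset) s t k := by
  have hsub : l.toFinset ⊆ A := fun e he => hA e (List.mem_toFinset.1 he)
  have := Finset.sum_sdiff (f := G.boundary) hsub
  rw [h, hl.sum_boundary, succ_nsmul] at this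
  exact add_right_cancel this

/-- Flow decomposition. -/
theorem IsFlow.exists_edgeDisjointPaths [Fintype V] {G : CostDigraph V E} {s t : V} :
    ∀ {k : ℕ} {A : Finset E}, G.IsFlow A s t k →
      ∃ P : Fin k → List E, G.EdgeDisjointPaths A s t P
  | 0, _, _ => ⟨fun _ => [], fun j => j.elim0, fun j => j.elim0⟩
  | k + 1, A, h => by
    obtain ⟨l, hl, hA⟩ := h.exists_isPath k.succ_pos
    obtain ⟨P, hP, hd⟩ := (h.sdiff_path hl hA).exists_edgeDisjointPaths
    have hdis : ∀ j, List.Disjoint l (P j) := fun j a ha hb => by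
      have := (hP j).2 a hb
      simp [ha] at this
    refine ⟨Fin.cons l P, fun j => ?_, fun j j' hne => ?_⟩
    · refine Fin.cases ⟨hl, hA⟩ (fun j => ?_) j
      exact ⟨(hP j).1, fun e he => (Finset.mem_sdiff.1 ((hP j).2 e he)).1⟩
    · revert hne
      refine Fin.cases ?_ (fun j => ?_) j <;> refine Fin.cases ?_ (fun j' => ?_) j'
      · exact fun h => absurd rfl h
      · exact fun _ => hdis j'
      · exact fun _ => (hdis j).symm
      · exact fun h => hd fun h' => h (congrArg Fin.succ h')

theorem EdgeDisjointPaths.isFlow {G : CostDigraph V E}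
    {A : Finset E} {s t : V} {k : ℕ} {P : Fin k → List E} (h : G.EdgeDisjointPaths A s t P) :
    G.IsFlow (pathEdges P) s t k := by
  rw [IsFlow, h.sum_pathEdges, Finset.sum_congr rfl fun j _ => (h.1 j).1.1.sum_boundary]
  rw [Finset.sum_const, Finset.card_univ, Fintype.card_fin]

theorem residual_boundary (G : CostDigraph V E) (S : Finset E) :
    (G.residual S).boundary = signed S G.boundary := by
  ext1 e
  by_cases he : e ∈ S <;> simp [boundary, residual, signed, he]

theorem sum_boundary_symmDiff (G : CostDigraph V E) (S C : Finset E) :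
    ∑ e ∈ symmDiff S C, G.boundary e =
      ∑ e ∈ S, G.boundary e + ∑ e ∈ C, (G.residual S).boundary e := by
  rw [sum_symmDiff, residual_boundary]

theorem sum_residual_boundary (G : CostDigraph V E) (S A : Finset E) :
    ∑ e ∈ symmDiff S A, (G.residual S).boundary e =
      ∑ e ∈ A, G.boundary e - ∑ e ∈ S, G.boundary e := by
  have := G.sum_boundary_symmDiff S (symmDiff S A)
  rw [symmDiff_symmDiff_cancel_left] at this
  rw [this]
  abel

/-- An edge of `S` missing from `A` counts as reversed, so the boundary of the symmetric difference
in the residual network is the difference of the two boundaries. -/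
theorem IsFlow.residual {G : CostDigraph V E} {S A : Finset E} {s t : V} {k j : ℕ}
    (hS : G.IsFlow S s t k) (hA : G.IsFlow A s t (k + j)) :
    (G.residual S).IsFlow (symmDiff S A) s t j := by
  rw [IsFlow, sum_residual_boundary, hA, hS, add_nsmul]
  abel

theorem IsFlow.augment {G : CostDigraph V E} {S C : Finset E} {s t : V} {k j : ℕ}
    (hS : G.IsFlow S s t k) (hC : (G.residual S).IsFlow C s t j) :
    G.IsFlow (symmDiff S C) s t (k + j) := by
  rw [IsFlow, sum_boundary_symmDiff, hS, hC, add_nsmul]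

theorem IsPath.isFlow {G : CostDigraph V E} {l : List E} {s t : V} (h : G.IsPath s l t) :
    G.IsFlow l.toFinset s t 1 := by
  rw [IsFlow, h.sum_boundary, one_nsmul]

/-- Augmenting a flow of minimum weight along a shortest path of the residual network yields a flow
of minimum weight. -/
theorem IsFlow.weight_augment_le [Fintype V] {M : Type*} [AddCommGroup M] [LinearOrder M]
    [IsOrderedAddMonoid M] {G : CostDigraph V E} {S : Finset E} {s t : V} {k : ℕ} {w : E → M}
    (hS : G.IsFlow S s t k) (hmin : ∀ B, G.IsFlow B s t k → ∑ e ∈ S, w e ≤ ∑ e ∈ B, w e)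
    {l : List E}
    (hl : ∀ l', (G.residual S).IsPath s l' t →
      ∑ e ∈ l.toFinset, signed S w e ≤ ∑ e ∈ l'.toFinset, signed S w e)
    {A : Finset E} (hA : G.IsFlow A s t (k + 1)) :
    ∑ e ∈ symmDiff S l.toFinset, w e ≤ ∑ e ∈ A, w e := by
  have hR := hS.residual hA
  obtain ⟨l', hl', hsub⟩ := hR.exists_isPath one_pos
  -- What remains beside the path `l'` is a circulation. Augmenting `S` by it keeps the value k, so
  -- its residual weight is non-negative.
  have h0 := hmin _ (hS.augment (hR.sdiff_path (k := 0) hl' hsub))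
  rw [sum_symmDiff, le_add_iff_nonneg_right] at h0
  have h1 := Finset.sum_sdiff (f := signed S w)
    (show l'.toFinset ⊆ symmDiff S A from fun e he => hsub e (List.mem_toFinset.1 he))
  have h2 := sum_symmDiff S (symmDiff S A) w
  rw [symmDiff_symmDiff_cancel_left] at h2
  rw [sum_symmDiff, h2, ← h1]
  exact add_le_add_right ((hl l' hl').trans (le_add_of_nonneg_left h0)) _

/-- Exchange between a flow `A` to `t` and a flow `Q` to `v`: an edge `f` of `A` that enters `v` can
be moved to `Q`. -/
theorem IsFlow.exchange [Fintype V] {G : CostDigraph V E} {A Q : Finset E} {s t v : V} {k j : ℕ}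
    (hA : G.IsFlow A s t k) (hQ : G.IsFlow Q s v j)
    {f : E} (hfA : f ∈ A) (hfQ : f ∉ Q) (hf : G.tgt f = v) :
    ∃ C ⊆ symmDiff Q A, f ∈ C ∧
      (G.IsFlow (symmDiff A C) s t k ∧ G.IsFlow (symmDiff Q C) s v j ∨
        j < k ∧ G.IsFlow (symmDiff Q C) s v (j + 1)) := by
  have hfR : f ∈ symmDiff Q A := Finset.mem_symmDiff.2 (Or.inr ⟨hfA, hfQ⟩)
  have hft : (G.residual Q).tgt f = v := by simp [CostDigraph.residual, hfQ, hf]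
  obtain ⟨W, hy, hpath, hW⟩ :=
    (G.residual Q).exists_reaching_set (symmDiff Q A) ((G.residual Q).src f)
  have hsub {l : List E} (hl : ∀ e ∈ l, e ∈ symmDiff Q A) :
      insert f l.toFinset ⊆ symmDiff Q A := fun e he => by
    rcases Finset.mem_insert.1 he with rfl | he
    exacts [hfR, hl e (List.mem_toFinset.1 he)]
  have hsum {l : List E} {u : V} (hl : (G.residual Q).IsPath u l ((G.residual Q).src f))
      (hfl : f ∉ l) : ∑ e ∈ insert f l.toFinset, (G.residual Q).boundary e =
        Pi.single v 1 - Pi.single u 1 := by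
    rw [Finset.sum_insert (by simpa using hfl), hl.sum_boundary, boundary, hft]
    abel
  -- If v reaches the tail of `f`, then `f` closes a cycle, and both flows keep their values when it
  -- is switched.
  by_cases hv : ∃ l, (G.residual Q).IsPath v l ((G.residual Q).src f) ∧ ∀ e ∈ l, e ∈ symmDiff Q A
  · obtain ⟨l, hl, hlR⟩ := hv
    have hfl : f ∉ l := fun h =>
      (List.nodup_cons.1 hl.2).1 (List.mem_map.2 ⟨f, h, hft⟩)
    have hQ' : G.IsFlow (symmDiff Q (insert f l.toFinset)) s v j := by
      rw [IsFlow, sum_boundary_symmDiff, hsum hl hfl, sub_self, add_zero, hQ]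
    refine ⟨_, hsub hlR, Finset.mem_insert_self _ _, Or.inl ⟨?_, hQ'⟩⟩
    have := sum_exchange (hsub hlR) G.boundary
    rw [hQ', hQ] at this
    exact (add_right_cancel this).trans hA
  · have hvW : v ∉ W := fun h => hv (hpath v h)
    -- No edge enters `W` and `f` leaves it, so its excess is negative. As v is not in `W`, this
    -- forces s ∈ W and j < k, and a path from s through `f` augments `Q`.
    have hneg := (G.residual Q).sum_boundary_neg hW hfR hy (by rwa [hft])
    rw [sum_residual_boundary, hA, hQ] at hneg
    simp only [Pi.sub_apply _ _ (_ : V)] at hneg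
    rw [Finset.sum_sub_distrib, sum_flow, sum_flow, if_neg hvW] at hneg
    have hsW : s ∈ W := by
      by_contra hs
      simp only [hs, if_false, sub_zero, mul_zero] at hneg
      split_ifs at hneg <;> omega
    rw [if_pos hsW] at hneg
    have hjk : j < k := by
      by_contra hjk
      split_ifs at hneg <;> omega
    obtain ⟨l, hl, hlR⟩ := hpath s hsW
    -- If the path used `f`, it would visit v, and its remainder would lead from v to the tail of
    -- `f`.
    have hfl : f ∉ l := fun h => by
      obtain ⟨l', h1, h2⟩ := hl.exists_suffix
        (List.mem_cons_of_mem _ (List.mem_map.2 ⟨f, h, hft⟩))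
      exact hv ⟨l', h1, fun e he => hlR e (h2 he)⟩
    refine ⟨_, hsub hlR, Finset.mem_insert_self _ _, Or.inr ⟨hjk, ?_⟩⟩
    rw [IsFlow, sum_boundary_symmDiff, hsum hl hfl, hQ, succ_nsmul]

end Flow

/-! ### Lexicographic weights and the analysis of one iteration. -/

section Augmentation

variable [DecidableEq E]

/-- The weight of an edge: its cost, then whether it lies outside `H`. -/
def lexWeight (G : CostDigraph V E) (H : Finset E) (e : E) : ℝ ×ₗ ℤ :=
  toLex (G.cost e, if e ∈ H then 0 else 1)

theorem sum_lexWeight (G : CostDigraph V E) (H A : Finset E) :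
    ∑ e ∈ A, G.lexWeight H e = toLex (∑ e ∈ A, G.cost e, ((A \ H).card : ℤ)) := by
  have h : ((A \ H).card : ℤ) = ∑ e ∈ A, if e ∈ H then 0 else 1 := by
    rw [Finset.sdiff_eq_filter, Finset.card_filter, Nat.cast_sum]
    exact Finset.sum_congr rfl fun e _ => by split_ifs <;> simp_all
  rw [h]
  clear h
  induction A using Finset.induction_on with
  | empty => rfl
  | insert a A ha ih => rw [Finset.sum_insert ha, ih, Finset.sum_insert ha, Finset.sum_insert ha]; rfl

theorem cost_le_of_lexWeight_le {G : CostDigraph V E} {H A B : Finset E}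
    (h : ∑ e ∈ A, G.lexWeight H e ≤ ∑ e ∈ B, G.lexWeight H e) :
    ∑ e ∈ A, G.cost e ≤ ∑ e ∈ B, G.cost e := by
  rw [sum_lexWeight, sum_lexWeight, Prod.Lex.toLex_le_toLex] at h
  exact h.elim le_of_lt fun h => h.1.le

/-- A set inside `H` has second coordinate 0, so minimality in cost already gives minimality in the
lexicographic weight. -/
theorem lexWeight_le_of_subset {G : CostDigraph V E} {H S B : Finset E} (hS : S ⊆ H)
    (h : ∑ e ∈ S, G.cost e ≤ ∑ e ∈ B, G.cost e) :
    ∑ e ∈ S, G.lexWeight H e ≤ ∑ e ∈ B, G.lexWeight H e := by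
  rw [sum_lexWeight, sum_lexWeight, Prod.Lex.toLex_le_toLex, Finset.sdiff_eq_empty_iff_subset.2 hS]
  refine h.lt_or_eq.imp id fun h => ⟨h, ?_⟩
  simp

theorem lexWeight_lt_of_subset {G : CostDigraph V E} {H S B : Finset E} (hS : S ⊆ H)
    (h : ∑ e ∈ S, G.cost e ≤ ∑ e ∈ B, G.cost e) {f : E} (hf : f ∈ B) (hfH : f ∉ H) :
    ∑ e ∈ S, G.lexWeight H e < ∑ e ∈ B, G.lexWeight H e := by
  rw [sum_lexWeight, sum_lexWeight, Prod.Lex.toLex_lt_toLex, Finset.sdiff_eq_empty_iff_subset.2 hS]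
  refine h.lt_or_eq.imp id fun h => ⟨h, ?_⟩
  simpa using Finset.card_pos.2 ⟨f, Finset.mem_sdiff.2 ⟨hf, hfH⟩⟩

theorem lexWeight_nonneg {G : CostDigraph V E} (hcost : ∀ e, 0 ≤ G.cost e) (H : Finset E) (e : E) :
    0 ≤ G.lexWeight H e := by
  refine Prod.Lex.toLex_le_toLex.2 ((hcost e).lt_or_eq.imp id fun h => ⟨h, ?_⟩)
  dsimp only
  split_ifs <;> simp

theorem lexWeight_pos {G : CostDigraph V E} (hcost : ∀ e, 0 ≤ G.cost e) {H : Finset E} {e : E}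
    (he : e ∉ H) : 0 < G.lexWeight H e := by
  refine Prod.Lex.toLex_lt_toLex.2 ((hcost e).lt_or_eq.imp id fun h => ⟨h, ?_⟩)
  simp [he]

/-- Reversed edges lie in `H`, so negation affects only their cost; the integer coordinate still
counts the edges outside `H`. -/
theorem sum_map_signed_lexWeight (G : CostDigraph V E) {S H : Finset E} (hS : S ⊆ H)
    (l : List E) : (l.map (signed S (G.lexWeight H))).sum =
      toLex ((G.residual S).pathCost l, (l.countP (· ∉ H) : ℤ)) := by
  induction l with
  | nil => rfl
  | cons a l ih =>
    have hcost : (G.residual S).pathCost (a :: l) =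
        (G.residual S).cost a + (G.residual S).pathCost l := by simp [pathCost]
    rw [List.map_cons, List.sum_cons, ih, List.countP_cons, hcost, add_comm (List.countP _ l)]
    have h : signed S (G.lexWeight H) a =
        toLex ((G.residual S).cost a, ((if decide (a ∉ H) = true then 1 else 0 : ℕ) : ℤ)) := by
      by_cases ha : a ∈ S
      · simp only [signed, residual, if_pos ha, lexWeight, hS ha, ← toLex_neg]
        simp
      · by_cases haH : a ∈ H <;> simp [signed, residual, ha, lexWeight, haH]
    rw [h, Nat.cast_add]
    rfl

theorem IsShortestPath.signed_le {G : CostDigraph V E} {S H : Finset E} (hS : S ⊆ H) {s t : V}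
    {l l' : List E} (hl : (G.residual S).IsShortestPath H s l t)
    (hl' : (G.residual S).IsPath s l' t) :
    ∑ e ∈ l.toFinset, signed S (G.lexWeight H) e ≤
      ∑ e ∈ l'.toFinset, signed S (G.lexWeight H) e := by
  have h := Prod.Lex.toLex_le_toLex.1 (hl.2 l' hl')
  rw [List.sum_toFinset _ hl.1.nodup, List.sum_toFinset _ hl'.nodup,
    sum_map_signed_lexWeight _ hS, sum_map_signed_lexWeight _ hS, Prod.Lex.toLex_le_toLex]
  exact h.imp id fun h => ⟨h.1, Nat.cast_le.2 h.2⟩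

variable [DecidableEq V]

/-- A flow of minimum positive weight does not enter its source. -/
theorem IsFlow.tgt_ne_source [Fintype V] {M : Type*} [AddCommGroup M] [LinearOrder M]
    [IsOrderedAddMonoid M] {G : CostDigraph V E} {A : Finset E} {s t : V} {k : ℕ} {w : E → M}
    (hA : G.IsFlow A s t k) (hmin : ∀ B, G.IsFlow B s t k → ∑ e ∈ A, w e ≤ ∑ e ∈ B, w e)
    (hw : ∀ e, 0 ≤ w e) {f : E} (hf : f ∈ A) (hwf : 0 < w f) : G.tgt f ≠ s := by
  intro hfs
  -- From s to s the empty set is a flow of any value; the value k rules out the second alternative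
  -- of the exchange.
  have h0 : G.IsFlow ∅ s s k := by simp [IsFlow]
  obtain ⟨C, hC, hfC, ⟨h1, -⟩ | ⟨h1, -⟩⟩ := hA.exchange h0 hf (Finset.notMem_empty f) hfs
  · have h2 := sum_exchange hC w
    have h3 : 0 < ∑ e ∈ symmDiff ∅ C, w e := by
      refine Finset.sum_pos' (fun e _ => hw e) ⟨f, ?_, hwf⟩
      simpa [Finset.mem_symmDiff] using hfC
    rw [Finset.sum_empty, add_zero] at h2
    exact ((hmin _ h1).trans_lt (lt_add_of_pos_right _ h3)).ne h2.symm
  · exact lt_irrefl _ h1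

/-- The choices made in one iteration, as far as they matter for its analysis: for every `t ≠ s` a
flow `S t` of value `i` and minimum cost inside `H`, and a shortest path `l t` of its residual
network. The in-degrees in `H` are `i`. -/
structure IsAugmentation (G : CostDigraph V E) (s : V) (i : ℕ) (H : Finset E)
    (S : V → Finset E) (l : V → List E) : Prop where
  subset : ∀ t, t ≠ s → S t ⊆ H
  isFlow : ∀ t, t ≠ s → G.IsFlow (S t) s t i
  cost_le : ∀ t, t ≠ s → ∀ B, G.IsFlow B s t i → ∑ e ∈ S t, G.cost e ≤ ∑ e ∈ B, G.cost e
  isShortestPath : ∀ t, t ≠ s → (G.residual (S t)).IsShortestPath H s (l t) t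
  inDegree_eq : ∀ t, t ≠ s → G.inDegree H t = i

namespace IsAugmentation

variable {G : CostDigraph V E} {s t : V} {i : ℕ} {H : Finset E} {S : V → Finset E}
  {l : V → List E}

/-- An edge of `S t` leaving t would force more than i edges of `S t` into t, but `H` has only i. -/
theorem src_ne (h : G.IsAugmentation s i H S l) (ht : t ≠ s) {e : E} (he : e ∈ S t) :
    G.src e ≠ t := by
  intro hs
  have h1 := (h.isFlow t ht).inDegree_eq ht
  have h2 : G.inDegree (S t) t ≤ G.inDegree H t :=
    Finset.card_le_card (Finset.filter_subset_filter _ (h.subset t ht))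
  have h3 : 0 < ((S t).filter fun e => G.src e = t).card :=
    Finset.card_pos.2 ⟨e, Finset.mem_filter.2 ⟨he, hs⟩⟩
  rw [h.inDegree_eq t ht] at h2
  omega

theorem mem_of_tgt_eq (h : G.IsAugmentation s i H S l) (ht : t ≠ s) {e : E} (he : e ∈ H)
    (het : G.tgt e = t) : e ∈ S t := by
  have h1 : G.inDegree (S t) t = i + _ := (h.isFlow t ht).inDegree_eq ht
  have h2 : (S t).filter (fun e => G.tgt e = t) = H.filter fun e => G.tgt e = t := by
    refine Finset.eq_of_subset_of_card_le (Finset.filter_subset_filter _ (h.subset t ht)) ?_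
    change G.inDegree H t ≤ G.inDegree (S t) t
    rw [h.inDegree_eq t ht]
    omega
  exact (Finset.mem_filter.1 (h2 ▸ Finset.mem_filter.2 ⟨he, het⟩ :
    e ∈ (S t).filter fun e => G.tgt e = t)).1

/-- The last edge is not reversed, since no edge of `S t` leaves t. It is not in `H` either, since
`S t` already holds all edges of `H` into t. -/
theorem getLast (h : G.IsAugmentation s i H S l) (ht : t ≠ s) {e : E}
    (he : (l t).getLast? = some e) : G.tgt e = t ∧ e ∉ H := by
  have h1 := (h.isShortestPath t ht).1.1.getLast_tgt he
  have h2 : e ∉ S t := fun heS => by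
    rw [CostDigraph.residual] at h1
    exact h.src_ne ht heS (by simpa [heS] using h1)
  have h3 : G.tgt e = t := by
    rw [CostDigraph.residual] at h1
    simpa [h2] using h1
  exact ⟨h3, fun heH => h2 (h.mem_of_tgt_eq ht heH h3)⟩

theorem exists_getLast (h : G.IsAugmentation s i H S l) (ht : t ≠ s) :
    ∃ e, (l t).getLast? = some e := by
  have h1 := (h.isShortestPath t ht).1.1
  cases hl : l t with
  | nil =>
    rw [hl] at h1
    exact absurd h1.symm ht
  | cons b l => exact ⟨_, List.getLast?_eq_some_getLast (by simp)⟩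

theorem lexWeight_le (h : G.IsAugmentation s i H S l) (ht : t ≠ s) {B : Finset E}
    (hB : G.IsFlow B s t i) : ∑ e ∈ S t, G.lexWeight H e ≤ ∑ e ∈ B, G.lexWeight H e :=
  lexWeight_le_of_subset (h.subset t ht) (h.cost_le t ht B hB)

theorem isFlow_augment (h : G.IsAugmentation s i H S l) (ht : t ≠ s) :
    G.IsFlow (symmDiff (S t) (l t).toFinset) s t (i + 1) :=
  (h.isFlow t ht).augment (h.isShortestPath t ht).1.isFlow

theorem lexWeight_augment_le [Fintype V] (h : G.IsAugmentation s i H S l) (ht : t ≠ s)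
    {B : Finset E} (hB : G.IsFlow B s t (i + 1)) :
    ∑ e ∈ S t, G.lexWeight H e + ∑ e ∈ (l t).toFinset, signed (S t) (G.lexWeight H) e ≤
      ∑ e ∈ B, G.lexWeight H e := by
  rw [← sum_symmDiff]
  exact (h.isFlow t ht).weight_augment_le (fun B => h.lexWeight_le ht)
    (fun l' => (h.isShortestPath t ht).signed_le (h.subset t ht)) hB

/-- If a flow to `t` of minimum weight enters `v` by an edge outside `H`, then `v` has a shorter
augmenting path than `t`. -/
theorem length_lt [Fintype V] (h : G.IsAugmentation s i H S l) (hcost : ∀ e, 0 ≤ G.cost e)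
    (ht : t ≠ s) {v : V} (hv : v ≠ s) (hvt : v ≠ t) {A : Finset E} (hA : G.IsFlow A s t (i + 1))
    (hmin : ∀ B, G.IsFlow B s t (i + 1) → ∑ e ∈ A, G.lexWeight H e ≤ ∑ e ∈ B, G.lexWeight H e)
    {f : E} (hf : f ∈ A) (hfH : f ∉ H) (hfv : G.tgt f = v) :
    ∑ e ∈ (l v).toFinset, signed (S v) (G.lexWeight H) e <
      ∑ e ∈ (l t).toFinset, signed (S t) (G.lexWeight H) e := by
  have hfS : f ∉ S v := fun hfS => hfH (h.subset v hv hfS)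
  obtain ⟨C, hC, hfC, ⟨h1, h2⟩ | ⟨-, h2⟩⟩ := hA.exchange (h.isFlow v hv) hf hfS hfv
  -- Here `S v` would become strictly heavier by gaining `f`, so `A` would become strictly lighter.
  · have h3 := lexWeight_lt_of_subset (h.subset v hv) (h.cost_le v hv _ h2)
      (Finset.mem_symmDiff.2 (Or.inr ⟨hfC, hfS⟩)) hfH
    exact absurd (sum_exchange hC (G.lexWeight H)) (add_lt_add_of_le_of_lt (hmin _ h1) h3).ne'
  · set A' := symmDiff A C with hA'
    have hex : ∑ e ∈ A', G.boundary e =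
        (i + 1) • (Pi.single t 1 - Pi.single s 1) - (Pi.single v 1 - Pi.single s 1) := by
      have h3 := sum_exchange hC G.boundary
      rw [h2, hA, h.isFlow v hv, succ_nsmul _ i, succ_nsmul _ i] at h3
      rw [succ_nsmul, eq_sub_iff_add_eq]
      refine add_right_cancel (b := i • (Pi.single v 1 - Pi.single s 1 : V → ℤ)) ?_
      rw [← h3]
      abel
    -- the remainder of `A` splits into a path from `v` to `t` and a flow from `s` to `t`
    obtain ⟨L, hL, hLA⟩ : ∃ L, G.IsPath v L t ∧ ∀ e ∈ L, e ∈ A' := by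
      refine G.exists_isPath_of_excess fun W htW hvW => ?_
      rw [hex]
      simp only [Pi.sub_apply _ _ (_ : V)]
      rw [Finset.sum_sub_distrib, sum_flow, Finset.sum_sub_distrib, sum_single_apply,
        sum_single_apply, if_pos htW, if_neg hvW]
      split_ifs <;> push_cast <;> omega
    have hsub : L.toFinset ⊆ A' := fun e he => hLA e (List.mem_toFinset.1 he)
    have hB : G.IsFlow (A' \ L.toFinset) s t i := by
      have h3 := Finset.sum_sdiff (f := G.boundary) hsub
      rw [hex, hL.sum_boundary, succ_nsmul, ← eq_sub_iff_add_eq] at h3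
      rw [IsFlow, h3]
      abel
    -- The excess of `A'` at t is i + 1, which exceeds the in-degree i of t in `H`.
    obtain ⟨g, hg, hgH⟩ : ∃ g ∈ A', g ∉ H := by
      by_contra! hcon
      have h3 : G.inDegree A' t ≤ G.inDegree H t :=
        Finset.card_le_card (Finset.filter_subset_filter _ hcon)
      have h4 := G.sum_boundary_apply A' t
      rw [hex] at h4
      simp [ht, hvt.symm] at h4
      rw [h.inDegree_eq t ht] at h3
      omega
    have hlt : ∑ e ∈ S t, G.lexWeight H e < ∑ e ∈ A', G.lexWeight H e :=
      lexWeight_lt_of_subset (h.subset t ht) ((h.cost_le t ht _ hB).trans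
        (Finset.sum_le_sum_of_subset_of_nonneg Finset.sdiff_subset fun e _ _ => hcost e)) hg hgH
    -- With w the weight and d the length, w(S_t) + w(S_v) + d(v) < w(A') + w(S_v △ C) = w(A) +
    -- w(S_v) ≤ w(S_t) + d(t) + w(S_v); cancel.
    have h5 := h.lexWeight_augment_le hv h2
    have h6 := hmin _ (h.isFlow_augment ht)
    rw [sum_symmDiff] at h6
    have h7 := sum_exchange hC (G.lexWeight H)
    have h8 := add_lt_add_of_lt_of_le hlt h5
    rw [h7] at h8
    have h9 := h8.trans_le (add_le_add_left h6 _)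
    rw [← add_assoc, add_comm (∑ e ∈ S t, _), add_assoc, add_comm (∑ e ∈ S t, _ + _),
      add_lt_add_iff_left, add_lt_add_iff_left] at h9
    exact h9

/-- After the iteration, `H'` contains a flow of value `i + 1` and minimum weight to every vertex. -/
theorem exists_flow [Fintype V] (h : G.IsAugmentation s i H S l) (hcost : ∀ e, 0 ≤ G.cost e)
    {H' : Finset E} (hH' : ∀ e, e ∈ H' ↔ e ∈ H ∨ ∃ t, t ≠ s ∧ (l t).getLast? = some e) (t : V)
    (ht : t ≠ s) : ∃ A ⊆ H', G.IsFlow A s t (i + 1) ∧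
      ∀ B, G.IsFlow B s t (i + 1) → ∑ e ∈ A, G.lexWeight H e ≤ ∑ e ∈ B, G.lexWeight H e := by
  classical
  let D : V → ℝ ×ₗ ℤ := fun t => ∑ e ∈ (l t).toFinset, signed (S t) (G.lexWeight H) e
  induction t using (@Finite.to_wellFoundedLT V _ (Preorder.lift D)).wf.induction with
  | _ t ih =>
  -- The augmented flow qualifies: its edges into t come from `S t` or are the last edge of `l t`.
  -- The requirement on edges into t ensures below that the head of `f` is not t, as `length_lt`
  -- demands.
  have key : ∃ m, ∃ A : Finset E, (A \ H').card = m ∧ G.IsFlow A s t (i + 1) ∧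
      (∀ B, G.IsFlow B s t (i + 1) → ∑ e ∈ A, G.lexWeight H e ≤ ∑ e ∈ B, G.lexWeight H e) ∧
      ∀ e ∈ A, G.tgt e = t → e ∈ H' := by
    refine ⟨_, _, rfl, h.isFlow_augment ht, fun B hB => ?_, fun e he het => (hH' e).2 ?_⟩
    · rw [sum_symmDiff]
      exact h.lexWeight_augment_le ht hB
    · rcases Finset.mem_symmDiff.1 he with ⟨he, -⟩ | ⟨he, heS⟩
      · exact Or.inl (h.subset t ht he)
      · refine Or.inr ⟨t, ht, (h.isShortestPath t ht).1.getLast?_eq_of_tgt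
          (List.mem_toFinset.1 he) ?_⟩
        simp [CostDigraph.residual, heS, het]
  obtain ⟨A, hcard, hA, hmin, hAt⟩ := Nat.find_spec key
  refine ⟨A, fun f hf => ?_, hA, hmin⟩
  by_contra hfH'
  have hfH : f ∉ H := fun hfH => hfH' ((hH' f).2 (Or.inl hfH))
  have hvs : G.tgt f ≠ s := hA.tgt_ne_source hmin (lexWeight_nonneg hcost H) hf
    (lexWeight_pos hcost hfH)
  have hvt : G.tgt f ≠ t := fun hvt => hfH' (hAt f hf hvt)
  obtain ⟨Q, hQH', hQ, hQmin⟩ :=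
    ih _ (h.length_lt hcost ht hvs hvt hA hmin hf hfH rfl) hvs
  -- Both flows have value i + 1, so only the value-preserving exchange can occur.
  obtain ⟨C, hC, hfC, ⟨h1, h2⟩ | ⟨h1, -⟩⟩ := hA.exchange hQ hf (fun hfQ => hfH' (hQH' hfQ)) rfl
  · have hsub : ∀ e ∈ symmDiff A C, e ∈ A ∨ e ∈ H' := fun e he => by
      rcases Finset.mem_symmDiff.1 he with ⟨he, -⟩ | ⟨he, heA⟩
      · exact Or.inl he
      · rcases Finset.mem_symmDiff.1 (hC he) with ⟨he, -⟩ | ⟨he, -⟩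
        exacts [Or.inr (hQH' he), absurd he heA]
    have h3 : ∑ e ∈ symmDiff A C, G.lexWeight H e ≤ ∑ e ∈ A, G.lexWeight H e := by
      refine le_of_add_le_add_right
        ((add_le_add_right (hQmin _ h2) _).trans (sum_exchange hC (G.lexWeight H)).le)
    refine Nat.find_min key (m := (symmDiff A C \ H').card) ?_ ⟨_, rfl, h1,
      fun B hB => h3.trans (hmin B hB), fun e he het => (hsub e he).elim (hAt e · het) id⟩
    rw [← hcard]
    refine Finset.card_lt_card ⟨fun e he => ?_, fun hle => ?_⟩
    · obtain ⟨he, heH'⟩ := Finset.mem_sdiff.1 he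
      exact Finset.mem_sdiff.2 ⟨(hsub e he).resolve_right heH', heH'⟩
    · have := (Finset.mem_sdiff.1 (hle (Finset.mem_sdiff.2 ⟨hf, hfH'⟩))).1
      simp [Finset.mem_symmDiff, hf, hfC] at this
  · exact lt_irrefl _ h1

end IsAugmentation

end Augmentation

/-! ### The invariant along the construction, and existence of the choices. -/

section Construction

variable [Fintype V] [Fintype E] [DecidableEq V] [DecidableEq E]

theorem MinCostPaths.isFlow_cost_le {G : CostDigraph V E} (hcost : ∀ e, 0 ≤ G.cost e) {s t : V}
    {k : ℕ} {P : Fin k → List E} (hP : G.MinCostPaths Finset.univ s t P) {B : Finset E}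
    (hB : G.IsFlow B s t k) : G.totalCost P ≤ ∑ e ∈ B, G.cost e := by
  obtain ⟨Q, hQ⟩ := hB.exists_edgeDisjointPaths
  refine (hP.2 Q (hQ.mono (Finset.subset_univ _))).trans ?_
  rw [hQ.totalCost_eq]
  exact Finset.sum_le_sum_of_subset_of_nonneg hQ.pathEdges_subset fun e _ _ => hcost e

/-- The preserver property turns minimality within `H` into minimality among all flows in G, which
the exchange arguments need because they leave `H`. -/
theorem MultipathPreserver.isAugmentation {G : CostDigraph V E} (hcost : ∀ e, 0 ≤ G.cost e)
    {s : V} {i : ℕ} {H : Finset E} (hH : G.MultipathPreserver i s H)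
    (hdeg : ∀ t, t ≠ s → G.inDegree H t = i) {P : V → Fin i → List E} {π : V → List E}
    (hP : ∀ t, t ≠ s → G.MinCostPaths H s t (P t))
    (hπ : ∀ t, t ≠ s → (G.residual (pathEdges (P t))).IsShortestPath H s (π t) t) :
    G.IsAugmentation s i H (fun t => pathEdges (P t)) π where
  subset t ht := (hP t ht).1.pathEdges_subset
  isFlow t ht := (hP t ht).1.isFlow
  cost_le t ht B hB := by
    obtain ⟨R, hRH, hR⟩ := hH t ht
    rw [← (hP t ht).1.totalCost_eq]
    exact ((hP t ht).2 R hRH).trans (hR.isFlow_cost_le hcost hB)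
  isShortestPath := hπ
  inDegree_eq := hdeg

theorem Iteration.multipathPreserver {G : CostDigraph V E} (hcost : ∀ e, 0 ≤ G.cost e) {s : V}
    {i : ℕ} {H H' : Finset E} (h : G.Iteration s i H H') (hH : G.MultipathPreserver i s H)
    (hs : G.inDegree H s = 0) (hdeg : ∀ t, t ≠ s → G.inDegree H t = i) :
    G.MultipathPreserver (i + 1) s H' ∧ G.inDegree H' s = 0 ∧
      ∀ t, t ≠ s → G.inDegree H' t = i + 1 := by
  obtain ⟨P, π, hP, hπ, hH'⟩ := h
  have haug := hH.isAugmentation hcost hdeg hP hπ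
  refine ⟨fun t ht => ?_, ?_, fun t ht => ?_⟩
  · obtain ⟨A, hAH', hA, hmin⟩ := haug.exists_flow hcost hH' t ht
    obtain ⟨R, hR⟩ := hA.exists_edgeDisjointPaths
    refine ⟨R, hR.mono hAH', hR.mono (Finset.subset_univ _), fun Q hQ => ?_⟩
    rw [hR.totalCost_eq, hQ.totalCost_eq]
    exact (Finset.sum_le_sum_of_subset_of_nonneg hR.pathEdges_subset fun e _ _ => hcost e).trans
      (cost_le_of_lexWeight_le (hmin _ hQ.isFlow))
  · rw [inDegree, Finset.card_eq_zero, Finset.filter_eq_empty_iff] at hs ⊢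
    intro e he hes
    rcases (hH' e).1 he with he | ⟨t, ht, he⟩
    · exact hs he hes
    · exact ht ((haug.getLast ht he).1.symm.trans hes)
  · obtain ⟨e, he⟩ := haug.exists_getLast ht
    obtain ⟨het, heH⟩ := haug.getLast ht he
    have hfilter : H'.filter (fun e => G.tgt e = t) = insert e (H.filter fun e => G.tgt e = t) := by
      ext a
      simp only [Finset.mem_filter, Finset.mem_insert]
      constructor
      · rintro ⟨ha, hat⟩
        rcases (hH' a).1 ha with ha | ⟨u, hu, ha⟩
        · exact Or.inr ⟨ha, hat⟩
        · obtain rfl : t = u := hat.symm.trans (haug.getLast hu ha).1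
          exact Or.inl (Option.some.inj (ha.symm.trans he))
      · rintro (rfl | ⟨ha, hat⟩)
        · exact ⟨(hH' a).2 (Or.inr ⟨t, ht, he⟩), het⟩
        · exact ⟨(hH' a).2 (Or.inl ha), hat⟩
    rw [inDegree, hfilter, Finset.card_insert_of_notMem fun h => heH (Finset.mem_filter.1 h).1]
    exact congrArg (· + 1) (hdeg t ht)

theorem Constructed.multipathPreserver {G : CostDigraph V E} (hcost : ∀ e, 0 ≤ G.cost e) {s : V}
    {i : ℕ} {H : Finset E} (h : G.Constructed s i H) :
    G.MultipathPreserver i s H ∧ G.inDegree H s = 0 ∧ ∀ t, t ≠ s → G.inDegree H t = i := by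
  induction h with
  | zero =>
    refine ⟨fun t _ => ⟨fun j => j.elim0, ?_, ?_, ?_⟩, rfl, fun _ _ => rfl⟩
    · exact ⟨fun j => j.elim0, fun j => j.elim0⟩
    · exact ⟨fun j => j.elim0, fun j => j.elim0⟩
    · exact fun Q _ => by simp [totalCost]
  | succ _ h ih => exact h.multipathPreserver hcost ih.1 ih.2.1 ih.2.2

theorem EdgeOutconnected.exists_iteration {G : CostDigraph V E} {s : V} {p i : ℕ}
    (hconn : G.EdgeOutconnected p s) (hi : i < p) {H : Finset E}
    (hH : G.MultipathPreserver i s H) : ∃ H', G.Iteration s i H H' := by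
  classical
  have h : ∀ t, ∃ (P : Fin i → List E) (l : List E), t ≠ s →
      G.MinCostPaths H s t P ∧ (G.residual (pathEdges P)).IsShortestPath H s l t := by
    intro t
    by_cases ht : t = s
    · exact ⟨fun _ => [], [], fun h => absurd ht h⟩
    obtain ⟨P, hPH, hP⟩ := hH t ht
    obtain ⟨Q, hQ⟩ := hconn t ht
    obtain ⟨j, rfl⟩ := Nat.exists_eq_add_of_lt hi
    -- The flow of value p = i + j + 1 leaves a residual flow of value j + 1 > 0, hence an
    -- augmenting path.
    obtain ⟨l, hl, -⟩ := (hPH.isFlow.residual (j := j + 1) hQ.isFlow).exists_isPath j.succ_pos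
    obtain ⟨l, hl⟩ := (G.residual (pathEdges P)).exists_isShortestPath H hl
    exact ⟨P, l, fun _ => ⟨⟨hPH, fun R hR => hP.2 R (hR.mono (Finset.subset_univ _))⟩, hl⟩⟩
  choose P π h using h
  exact ⟨Finset.univ.filter fun e => e ∈ H ∨ ∃ t, t ≠ s ∧ (π t).getLast? = some e, P, π,
    fun t ht => (h t ht).1, fun t ht => (h t ht).2, fun e => by simp⟩

end Construction

end CostDigraph

theorem mainTheorem1 {V E : Type*} [Fintype V] [Fintype E] [DecidableEq V] [DecidableEq E]
    (G : CostDigraph V E) (hcost : ∀ e, 0 ≤ G.cost e) (s : V) (p : ℕ)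
    (hconn : G.EdgeOutconnected p s) :
    -- before the `p`-th iteration is completed, the next iteration can always be carried out
    (∀ i, i < p → ∀ H, G.Constructed s i H → ∃ H', G.Iteration s i H H') ∧
    -- whatever choices are made, the outcome of the `p`-th iteration has the claimed properties
    ∀ H, G.Constructed s p H →
      G.MultipathPreserver p s H ∧
      G.inDegree H s = 0 ∧
      (∀ t, t ≠ s → G.inDegree H t = p) ∧
      H.card = p * (Fintype.card V - 1) := by
  refine ⟨fun i hi H hH => hconn.exists_iteration hi (hH.multipathPreserver hcost).1, fun H hH => ?_⟩
  obtain ⟨h1, h2, h3⟩ := hH.multipathPreserver hcost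
  exact ⟨h1, h2, h3, G.card_eq_mul_of_inDegree h2 h3⟩
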